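/- Let $P_{XY}$ be a joint distribution on finite alphabets $\mathcal X\times\mathcal Y$ and let $\alpha\in(1,\infty)$. The maximal $\alpha$-leakage from $X$ to $Y$ is $$\mathcal L_\alpha^{\max}(X\to Y)=\sup_{U-X-Y}\ \lim_{\alpha'\to\alpha}\frac{\alpha'}{\alpha'-1}\log\frac{\max_{P_{\hat U|Y}}\mathbb E\big[\mathbb P(U=\hat U\mid U,Y)^{(\alpha'-1)/\alpha'}\big]}{\max_{P_{\hat U}}\mathbb E\big[\mathbb P(U=\hat U\mid U)^{(\alpha'-1)/\alpha'}\big]},$$ where the supremum is over all finite alphabets and all random variables $U$ on them, obtained from $X$ through a channel $P_{U|X}$, such that $U-X-Y$ is a Markov chain. In the numerator the guess $\hat U$ is drawn from $P_{\hat U|Y}$, so that $\mathbb P(U=\hat U\mid U=u,Y=y)=P_{\hat U|Y}(u|y)$; in the denominator it is drawn from $P_{\hat U}$, so that $\mathbb P(U=\hat U\mid U=u)=P_{\hat U}(u)$. For $f$ convex with $f(1)=0$ let $D_f(P\|Q)=\sum_z Q(z)\,f\big(P(z)/Q(z)\big)$, with the usual convention $0\cdot f(s/0)=s\lim_{t\to\infty}f(t)/t$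 (which is $0$ for $s=0$), and let $$\mathcal L_f^{\max}(X\to Y)=\sup_{P_{\tilde X}}\ \inf_{Q_Y}\ D_f\big(P_{\tilde X}P_{Y|X}\,\big\|\,P_{\tilde X}\times Q_Y\big),$$ where $P_{\tilde X}$ ranges over the distributions on $\mathcal X$ with the same support as $P_X$ and $Q_Y$ over all distributions on $\mathcal Y$. Let $f_\alpha(t)=\frac{t^\alpha-1}{\alpha-1}$, so that $D_{f_\alpha}$ is the Hellinger divergence of order $\alpha$. Then the limit in the definition of $\mathcal L_\alpha^{\max}$ exists for every such $U$, $\mathcal L_{f_\alpha}^{\max}(X\to Y)$ is finite and nonnegative, and $$\mathcal L_\alpha^{\max}(X\to Y)=\frac1{\alpha-1}\log\Big(1+(\alpha-1)\,\mathcal L_{f_\alpha}^{\max}(X\to Y)\Big).$$ -/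

import Mathlib

open Filter Topology
open scoped BigOperators

noncomputable section

namespace AlphaLeakage

universe u v w

/-- Probability distributions on a finite alphabet `A`, as real vectors. -/
abbrev Dist (A : Type u) [Fintype A] : Type u := stdSimplex ℝ A

/-- Channels (conditional distributions) from `A` to `B`. -/
abbrev Channel (A : Type u) (B : Type v) [Fintype B] : Type (max u v) := A → Dist B

section Joint

variable {X : Type u} {Y : Type v} [Fintype X] [Fintype Y]

/-- The marginal `P_X` of a joint distribution `P_{XY}`. -/
def margX (P : Dist (X × Y)) (x : X) : ℝ := ∑ y, P.1 (x, y)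

/-- The conditional probability `P_{Y|X}(y|x)`; equal to `0` at the letters `x` of probability
zero, where it never matters, since only input laws with the support of `P_X` are considered. -/
def condYX (P : Dist (X × Y)) (x : X) (y : Y) : ℝ := P.1 (x, y) / margX P x

/-- The law `P_{UY}` of `(U, Y)` when `U - X - Y` is the Markov chain determined by `P_{XY}`
and the channel `W = P_{U|X}`, i.e. `P_{UXY}(u,x,y) = P_{U|X}(u|x) P_{XY}(x,y)`. -/
def jointUY {U : Type w} [Fintype U] (P : Dist (X × Y)) (W : Channel X U) (i : U) (y : Y) : ℝ :=
  ∑ x, (W x).1 i * P.1 (x, y)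

/-- The law `P_U` of `U` in the Markov chain `U - X - Y` determined by `P_{XY}` and `W = P_{U|X}`. -/
def margU {U : Type w} [Fintype U] (P : Dist (X × Y)) (W : Channel X U) (i : U) : ℝ :=
  ∑ y, jointUY P W i y

/-- `max_{P_{Û|Y}} E[P(U = Û | U, Y)^((a-1)/a)]`: the largest expected gain of an adversary who
observes `Y` and guesses `U` by a random `Û` drawn from `P_{Û|Y}`. For `a > 1` the gain is continuous in `P_{Û|Y}` and at
most `1`, and the channels form a compact set, so the supremum is a maximum. -/
def gainWithY {U : Type w} [Fintype U] (P : Dist (X × Y)) (W : Channel X U) (a : ℝ) : ℝ :=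
  ⨆ V : Channel Y U, ∑ i, ∑ y, jointUY P W i y * (V y).1 i ^ ((a - 1) / a)

/-- `max_{P_Û} E[P(U = Û | U)^((a-1)/a)]`: the largest expected gain without observing `Y`. -/
def gainBlind {U : Type w} [Fintype U] (P : Dist (X × Y)) (W : Channel X U) (a : ℝ) : ℝ :=
  ⨆ V : Dist U, ∑ i, margU P W i * V.1 i ^ ((a - 1) / a)

/-- `a/(a-1) · log` of the ratio of the two maximal expected gains. -/
def logGain {U : Type w} [Fintype U] (P : Dist (X × Y)) (W : Channel X U) (a : ℝ) : ℝ :=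
  a / (a - 1) * Real.log (gainWithY P W a / gainBlind P W a)

/-- Maximal `α`-leakage from `X` to `Y`, for a finite order `α > 1`: the supremum over all Markov
chains `U - X - Y` with `U` in a finite alphabet, of the limit as `α' → α` of `logGain`.
Every finite alphabet is, up to relabelling, some `Fin n`. -/
def maxAlphaLeakage (P : Dist (X × Y)) (α : ℝ) : EReal :=
  ⨆ (n : ℕ) (W : Channel X (Fin n)), ((limUnder (𝓝[≠] α) (logGain P W) : ℝ) : EReal)

end Joint

/-- `lim_{t → ∞} f(t)/t` in the extended reals (the limit exists for convex `f`). -/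
def slopeAtTop (f : ℝ → ℝ) : EReal :=
  limsup (fun t : ℝ => ((f t / t : ℝ) : EReal)) atTop

/-- The `f`-divergence `D_f(p‖q) = ∑ q f(p/q)` on a finite alphabet, with the standard convention
`0 · f(s/0) = s · lim_{t → ∞} f(t)/t` (in particular `0 · f(0/0) = 0`). -/
def fDiv {A : Type u} [Fintype A] (f : ℝ → ℝ) (p q : A → ℝ) : EReal :=
  ∑ i, if q i = 0 then (p i : EReal) * slopeAtTop f else ((q i * f (p i / q i) : ℝ) : EReal)

/-- The distribution-independent `f`-leakage
`sup_{P_X̃} inf_{Q_Y} D_f(P_X̃ P_{Y|X} ‖ P_X̃ × Q_Y)`, where `P_X̃` ranges over the distributions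
with the same support as `P_X`. -/
def maxFLeakage {X : Type u} {Y : Type v} [Fintype X] [Fintype Y]
    (f : ℝ → ℝ) (P : Dist (X × Y)) : EReal :=
  ⨆ (R : Dist X) (_ : Function.support R.1 = Function.support (margX P)),
    ⨅ Q : Dist Y,
      fDiv f (fun z : X × Y => R.1 z.1 * condYX P z.1 z.2) (fun z : X × Y => R.1 z.1 * Q.1 z.2)

/-- The generator `f_α(t) = (t^α - 1)/(α - 1)` of the Hellinger divergence of order `α`. -/
def hellinger (α : ℝ) (t : ℝ) : ℝ := (t ^ α - 1) / (α - 1)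

end AlphaLeakage

end

/-! Both sides reduce to Gallager's sum `G(R) = gallagerSum α P R`. By Hölder, the best expected
gain against a weight vector is its `ℓ^a` norm, so `logGain` is explicit and continuous in the
order, and the limit is its value at `α`. On the other side, the inner infimum over `Q_Y` is
Sibson's identity: it equals `(G(R)^α - 1)/(α - 1)`.

It remains to match the supremum over `U` of `logGain` with the supremum over `R` of `α/(α-1) · log
G(R)`. Given `U`, Jensen bounds its gain by `G(R)`, where `R` mixes the posteriors `P_{X|U}` with
weights proportional to `P_U^α` (`exists_logGain_le`). Conversely, splitting each `x` into `m x`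
equiprobable letters makes Jensen tight and produces an `R` proportional to `m^(1-α) P_X^α`; every
`R` with the support of `P_X` is a limit of these (`le_maxAlphaLeakage`). The increasing map `s ↦
log(1 + (α-1)s)/(α-1)` carries one supremum to the other. -/

noncomputable section

namespace AlphaLeakage

universe u v w

/-! ### Closed form of the gains and existence of the limit -/

section Gain

/-- The value of `max_V ∑ w V^((a-1)/a)` over the simplex is the `ℓ^a` norm of `w`. -/
theorem isGreatest_sum_mul_rpow {U : Type w} [Fintype U] [Nonempty U] {a : ℝ} (ha : 1 < a)
    {c : U → ℝ} (hc : ∀ i, 0 ≤ c i) :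
    IsGreatest (Set.range fun V : Dist U => ∑ i, c i * V.1 i ^ ((a - 1) / a))
      ((∑ i, c i ^ a) ^ (1 / a)) := by
  have ha0 : 0 < a := by linarith
  have ha1 : 0 < a - 1 := by linarith
  constructor
  · by_cases hZ : ∑ i, c i ^ a = 0
    · have h0 : ∀ i, c i = 0 := by
        intro i
        have := (Finset.sum_eq_zero_iff_of_nonneg
          (fun i _ => Real.rpow_nonneg (hc i) a)).1 hZ i (Finset.mem_univ i)
        exact ((Real.rpow_eq_zero (hc i) ha0.ne').1 this)
      classical
      -- All weights vanish here, so any distribution attains the maximum `0`.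
      refine ⟨⟨Pi.single (Classical.arbitrary U) 1, single_mem_stdSimplex ℝ _⟩, ?_⟩
      have : 1 / a ≠ 0 := by positivity
      rw [hZ, Real.zero_rpow this]
      simp [h0]
    · have hZ0 : 0 < ∑ i, c i ^ a :=
        lt_of_le_of_ne (Finset.sum_nonneg fun i _ => Real.rpow_nonneg (hc i) a) (Ne.symm hZ)
      set Z := ∑ i, c i ^ a with hZdef
      -- The equality case of Hölder: the optimal guess is proportional to `c^a`.
      refine ⟨⟨fun i => c i ^ a / Z, fun i => div_nonneg (Real.rpow_nonneg (hc i) a) hZ0.le, ?_⟩, ?_⟩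
      · rw [← Finset.sum_div, ← hZdef, div_self hZ]
      · have key : ∀ i, c i * (c i ^ a / Z) ^ ((a - 1) / a) = c i ^ a / Z ^ ((a - 1) / a) := by
          intro i
          rw [Real.div_rpow (Real.rpow_nonneg (hc i) a) hZ0.le, ← Real.rpow_mul (hc i),
            mul_div_cancel₀ _ ha0.ne', ← mul_div_assoc]
          congr 1
          rcases (hc i).eq_or_lt with h | h
          · rw [← h, Real.zero_rpow ha0.ne', zero_mul]
          · rw [Real.rpow_sub_one h.ne']
            field_simp
        simp only [key]
        rw [← Finset.sum_div, ← hZdef]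
        nth_rewrite 1 [← Real.rpow_one Z]
        rw [← Real.rpow_sub hZ0]
        congr 1
        field_simp
        ring
  · rintro _ ⟨V, rfl⟩
    have hpq : a.HolderConjugate (a / (a - 1)) := Real.HolderConjugate.conjExponent ha
    refine (Real.inner_le_Lp_mul_Lq_of_nonneg Finset.univ hpq (fun i _ => hc i)
      (fun i _ => Real.rpow_nonneg (V.2.1 i) _)).trans ?_
    have : ∀ i, (V.1 i ^ ((a - 1) / a)) ^ (a / (a - 1)) = V.1 i := by
      intro i
      rw [← Real.rpow_mul (V.2.1 i)]
      have : (a - 1) / a * (a / (a - 1)) = 1 := by field_simp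
      rw [this, Real.rpow_one]
    simp only [this]
    rw [V.2.2, Real.one_rpow, mul_one]

variable {X : Type u} {Y : Type v} [Fintype X] [Fintype Y] {U : Type w} [Fintype U]

theorem nonempty_left (P : Dist (X × Y)) : Nonempty X := by
  by_contra h
  rw [not_nonempty_iff] at h
  have := P.2.2
  simp at this

theorem nonempty_of_dist (V : Dist U) : Nonempty U := by
  by_contra h
  rw [not_nonempty_iff] at h
  have := V.2.2
  simp at this

theorem nonempty_of_channel (P : Dist (X × Y)) (W : Channel X U) : Nonempty U :=
  nonempty_of_dist (W (nonempty_left P).some)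

theorem jointUY_nonneg (P : Dist (X × Y)) (W : Channel X U) (i : U) (y : Y) :
    0 ≤ jointUY P W i y :=
  Finset.sum_nonneg fun x _ => mul_nonneg ((W x).2.1 i) (P.2.1 _)

theorem margU_nonneg (P : Dist (X × Y)) (W : Channel X U) (i : U) : 0 ≤ margU P W i :=
  Finset.sum_nonneg fun y _ => jointUY_nonneg P W i y

theorem margX_nonneg (P : Dist (X × Y)) (x : X) : 0 ≤ margX P x :=
  Finset.sum_nonneg fun _ _ => P.2.1 _

theorem sum_margX (P : Dist (X × Y)) : ∑ x, margX P x = 1 := by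
  have := P.2.2
  rw [Fintype.sum_prod_type] at this
  exact this

theorem margU_eq (P : Dist (X × Y)) (W : Channel X U) (i : U) :
    margU P W i = ∑ x, (W x).1 i * margX P x := by
  simp only [margU, jointUY, margX, Finset.mul_sum]
  exact Finset.sum_comm

theorem sum_margU (P : Dist (X × Y)) (W : Channel X U) : ∑ i, margU P W i = 1 := by
  simp only [margU_eq]
  rw [Finset.sum_comm, ← sum_margX P]
  refine Finset.sum_congr rfl fun x _ => ?_
  rw [← Finset.sum_mul, (W x).2.2, one_mul]

theorem gainBlind_eq (P : Dist (X × Y)) (W : Channel X U) {a : ℝ} (ha : 1 < a) :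
    gainBlind P W a = (∑ i, margU P W i ^ a) ^ (1 / a) :=
  have := nonempty_of_channel P W
  (isGreatest_sum_mul_rpow ha (margU_nonneg P W)).csSup_eq

/-- A channel chooses its law separately for each `y`, so the maximization decouples into one `ℓ^a`
problem per `y`. -/
theorem gainWithY_eq (P : Dist (X × Y)) (W : Channel X U) {a : ℝ} (ha : 1 < a) :
    gainWithY P W a = ∑ y, (∑ i, jointUY P W i y ^ a) ^ (1 / a) := by
  have := nonempty_of_channel P W
  have h := fun y => isGreatest_sum_mul_rpow ha (fun i => jointUY_nonneg P W i y)
  refine IsGreatest.csSup_eq ⟨?_, ?_⟩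
  · choose V hV using fun y => (h y).1
    refine ⟨V, ?_⟩
    simp only [← hV]
    exact Finset.sum_comm
  · rintro _ ⟨V, rfl⟩
    simp only
    rw [Finset.sum_comm]
    exact Finset.sum_le_sum fun y _ => (h y).2 ⟨V y, rfl⟩

theorem sum_margU_rpow_pos (P : Dist (X × Y)) (W : Channel X U) (a : ℝ) :
    0 < ∑ i, margU P W i ^ a := by
  obtain ⟨i, -, hi⟩ : ∃ i ∈ Finset.univ, 0 < margU P W i := by
    apply Finset.exists_lt_of_sum_lt
    simp [sum_margU]
  exact Finset.sum_pos' (fun i _ => Real.rpow_nonneg (margU_nonneg P W i) a)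
    ⟨i, Finset.mem_univ i, Real.rpow_pos_of_pos hi a⟩

theorem sum_jointUY_rpow_pos (P : Dist (X × Y)) (W : Channel X U) (a : ℝ) :
    0 < ∑ y, (∑ i, jointUY P W i y ^ a) ^ (1 / a) := by
  have h1 : ∑ i, ∑ y, jointUY P W i y = 1 := sum_margU P W
  obtain ⟨i, -, hi⟩ : ∃ i ∈ Finset.univ, 0 < ∑ y, jointUY P W i y := by
    apply Finset.exists_lt_of_sum_lt
    simp [h1]
  obtain ⟨y, -, hy⟩ : ∃ y ∈ Finset.univ, 0 < jointUY P W i y := by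
    apply Finset.exists_lt_of_sum_lt
    simpa using hi
  have hn := fun y i => Real.rpow_nonneg (jointUY_nonneg P W i y) a
  refine Finset.sum_pos' (fun y _ => Real.rpow_nonneg (Finset.sum_nonneg fun i _ => hn y i) _)
    ⟨y, Finset.mem_univ y, Real.rpow_pos_of_pos ?_ _⟩
  exact Finset.sum_pos' (fun i _ => hn y i) ⟨i, Finset.mem_univ i, Real.rpow_pos_of_pos hy a⟩

theorem logGain_eq (P : Dist (X × Y)) (W : Channel X U) {a : ℝ} (ha : 1 < a) :
    logGain P W a = a / (a - 1) * Real.log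
      ((∑ y, (∑ i, jointUY P W i y ^ a) ^ (1 / a)) / (∑ i, margU P W i ^ a) ^ (1 / a)) := by
  rw [logGain, gainWithY_eq P W ha, gainBlind_eq P W ha]

theorem continuousAt_logGain (P : Dist (X × Y)) (W : Channel X U) {α : ℝ} (hα : 1 < α) :
    ContinuousAt (logGain P W) α := by
  have hα0 : α ≠ 0 := by linarith
  have hα1 : α - 1 ≠ 0 := by linarith
  have hev : logGain P W =ᶠ[𝓝 α] fun a => a / (a - 1) * Real.log
      ((∑ y, (∑ i, jointUY P W i y ^ a) ^ (1 / a)) / (∑ i, margU P W i ^ a) ^ (1 / a)) := by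
    filter_upwards [lt_mem_nhds hα] with a ha using logGain_eq P W ha
  refine ContinuousAt.congr ?_ hev.symm
  have hpow : ∀ c : ℝ, ContinuousAt (fun a : ℝ => c ^ a) α := fun c =>
    Real.continuousAt_const_rpow' hα0
  have hinv : ContinuousAt (fun a : ℝ => 1 / a) α := continuousAt_const.div continuousAt_id hα0
  have hD := Real.rpow_pos_of_pos (sum_margU_rpow_pos P W α) (1 / α)
  refine (continuousAt_id.div (continuousAt_id.sub continuousAt_const) hα1).mul ?_
  refine ContinuousAt.log (ContinuousAt.div ?_ ?_ hD.ne')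
    (div_pos (sum_jointUY_rpow_pos P W α) hD).ne'
  · refine tendsto_finsetSum _ fun y _ => ?_
    refine ContinuousAt.rpow (tendsto_finsetSum _ fun i _ => hpow _) hinv (Or.inr ?_)
    have : 0 < α := by linarith
    positivity
  · refine ContinuousAt.rpow (tendsto_finsetSum _ fun i _ => hpow _) hinv (Or.inr ?_)
    have : 0 < α := by linarith
    positivity

theorem tendsto_logGain (P : Dist (X × Y)) (W : Channel X U) {α : ℝ} (hα : 1 < α) :
    Tendsto (logGain P W) (𝓝[≠] α) (𝓝 (logGain P W α)) :=
  (continuousAt_logGain P W hα).tendsto.mono_left nhdsWithin_le_nhds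

theorem maxAlphaLeakage_eq (P : Dist (X × Y)) {α : ℝ} (hα : 1 < α) :
    maxAlphaLeakage P α = ⨆ (n : ℕ) (W : Channel X (Fin n)), ((logGain P W α : ℝ) : EReal) := by
  refine iSup_congr fun n => iSup_congr fun W => ?_
  rw [(tendsto_logGain P W hα).limUnder_eq]

end Gain

/-! ### Sibson's identity for the Hellinger divergence -/

section Hellinger

variable {X : Type u} {Y : Type v} [Fintype X] [Fintype Y]

theorem condYX_nonneg (P : Dist (X × Y)) (x : X) (y : Y) : 0 ≤ condYX P x y :=
  div_nonneg (P.2.1 _) (margX_nonneg P x)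

theorem le_margX (P : Dist (X × Y)) (x : X) (y : Y) : P.1 (x, y) ≤ margX P x :=
  Finset.single_le_sum (f := fun y => P.1 (x, y)) (fun _ _ => P.2.1 _) (Finset.mem_univ y)

theorem condYX_le_one (P : Dist (X × Y)) (x : X) (y : Y) : condYX P x y ≤ 1 :=
  div_le_one_of_le₀ (le_margX P x y) (margX_nonneg P x)

theorem margX_mul_condYX (P : Dist (X × Y)) (x : X) (y : Y) :
    margX P x * condYX P x y = P.1 (x, y) := by
  rcases eq_or_ne (margX P x) 0 with h | h
  · rw [h, zero_mul]
    exact le_antisymm (P.2.1 _) (h ▸ le_margX P x y)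
  · exact mul_div_cancel₀ _ h

theorem sum_condYX (P : Dist (X × Y)) {x : X} (hx : margX P x ≠ 0) : ∑ y, condYX P x y = 1 := by
  simp only [condYX]
  rw [← Finset.sum_div]
  exact div_self hx

/-- `∑_x R(x) P_{Y|X}(y|x)^α`. -/
def powerMean (α : ℝ) (P : Dist (X × Y)) (R : X → ℝ) (y : Y) : ℝ := ∑ x, R x * condYX P x y ^ α

/-- Gallager's sum `∑_y (∑_x R(x) P_{Y|X}(y|x)^α)^(1/α)`, the exponential of `(α-1)/α` times the
Sibson mutual information of order `α`. -/
def gallagerSum (α : ℝ) (P : Dist (X × Y)) (R : X → ℝ) : ℝ := ∑ y, powerMean α P R y ^ (1 / α)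

theorem powerMean_nonneg (α : ℝ) (P : Dist (X × Y)) (R : Dist X) (y : Y) :
    0 ≤ powerMean α P R.1 y :=
  Finset.sum_nonneg fun x _ => mul_nonneg (R.2.1 x) (Real.rpow_nonneg (condYX_nonneg P x y) _)

theorem sum_dist_mul_condYX (P : Dist (X × Y)) {R : Dist X}
    (hR : Function.support R.1 = Function.support (margX P)) :
    ∑ y, ∑ x, R.1 x * condYX P x y = 1 := by
  rw [Finset.sum_comm, ← R.2.2]
  refine Finset.sum_congr rfl fun x _ => ?_
  rw [← Finset.mul_sum]
  by_cases hx : R.1 x = 0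
  · rw [hx, zero_mul]
  · have : x ∈ Function.support (margX P) := hR ▸ (Function.mem_support.2 hx)
    rw [sum_condYX P this, mul_one]

/-- For each `y` the mean of order `α` dominates the arithmetic mean, and the arithmetic means sum
to `1`. This gives nonnegativity of the leakage and positivity inside the logarithms. -/
theorem one_le_gallagerSum (P : Dist (X × Y)) {α : ℝ} (hα : 1 < α) {R : Dist X}
    (hR : Function.support R.1 = Function.support (margX P)) : 1 ≤ gallagerSum α P R.1 := by
  have hα0 : 0 < α := by linarith
  rw [← sum_dist_mul_condYX P hR]
  refine Finset.sum_le_sum fun y _ => ?_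
  have h0 : 0 ≤ ∑ x, R.1 x * condYX P x y :=
    Finset.sum_nonneg fun x _ => mul_nonneg (R.2.1 x) (condYX_nonneg P x y)
  rw [one_div, Real.le_rpow_inv_iff_of_pos h0 (powerMean_nonneg α P R y) hα0]
  exact Real.rpow_arith_mean_le_arith_mean_rpow _ _ _ (fun x _ => R.2.1 x) R.2.2
    (fun x _ => condYX_nonneg P x y) hα.le

theorem gallagerSum_le_card (P : Dist (X × Y)) {α : ℝ} (hα : 1 < α) (R : Dist X) :
    gallagerSum α P R.1 ≤ Fintype.card Y := by
  have hα0 : 0 < α := by linarith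
  have : ∀ y ∈ (Finset.univ : Finset Y), powerMean α P R.1 y ^ (1 / α) ≤ 1 := fun y _ => by
    refine Real.rpow_le_one (powerMean_nonneg α P R y) ?_ (by positivity)
    rw [← R.2.2]
    refine Finset.sum_le_sum fun x _ => mul_le_of_le_one_right (R.2.1 x) ?_
    exact Real.rpow_le_one (condYX_nonneg P x y) (condYX_le_one P x y) hα0.le
  simpa [gallagerSum] using Finset.sum_le_card_nsmul _ _ _ this

theorem slopeAtTop_hellinger {α : ℝ} (hα : 1 < α) : slopeAtTop (hellinger α) = ⊤ := by
  have h1 : 0 < α - 1 := by linarith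
  refine Tendsto.limsup_eq (EReal.tendsto_coe_nhds_top_iff.2 ?_)
  have h2 : Tendsto (fun t : ℝ => (t ^ (α - 1) + -t⁻¹) / (α - 1)) atTop atTop :=
    (tendsto_atTop_add_right_of_le' atTop (-1) (tendsto_rpow_atTop h1) (by
      filter_upwards [eventually_ge_atTop 1] with t ht
      exact neg_le_neg (inv_le_one_of_one_le₀ ht))).atTop_div_const h1
  refine h2.congr' ?_
  filter_upwards [eventually_gt_atTop 0] with t ht
  rw [hellinger, Real.rpow_sub_one ht.ne']
  field_simp
  ring

theorem sum_ne_bot {ι : Type*} {s : Finset ι} {f : ι → EReal} (h : ∀ i ∈ s, f i ≠ ⊥) :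
    ∑ i ∈ s, f i ≠ ⊥ := by
  classical
  induction s using Finset.induction_on with
  | empty => simp
  | insert i s his ih =>
    rw [Finset.sum_insert his, EReal.add_ne_bot_iff]
    exact ⟨h i (Finset.mem_insert_self i s), ih fun j hj => h j (Finset.mem_insert_of_mem hj)⟩

theorem sum_eq_top {ι : Type*} {s : Finset ι} {f : ι → EReal} (h : ∀ i ∈ s, f i ≠ ⊥)
    {i : ι} (hi : i ∈ s) (htop : f i = ⊤) : ∑ i ∈ s, f i = ⊤ := by
  classical
  rw [← Finset.add_sum_erase s f hi, htop]
  exact EReal.top_add_of_ne_bot (sum_ne_bot fun j hj => h j (Finset.mem_of_mem_erase hj))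

theorem coe_mul_top_ne_bot {r : ℝ} (hr : 0 ≤ r) : (r : EReal) * ⊤ ≠ ⊥ := by
  rcases hr.eq_or_lt with h | h
  · simp [← h]
  · rw [EReal.coe_mul_top_of_pos h]
    exact top_ne_bot

theorem fDiv_hellinger_eq_top {A : Type u} [Fintype A] {α : ℝ} (hα : 1 < α) {p q : A → ℝ}
    (hp : ∀ i, 0 ≤ p i) (h : ∃ i, q i = 0 ∧ p i ≠ 0) : fDiv (hellinger α) p q = ⊤ := by
  obtain ⟨i, hq, hpi⟩ := h
  refine sum_eq_top (fun j _ => ?_) (Finset.mem_univ i) ?_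
  · rw [slopeAtTop_hellinger hα]
    split_ifs
    · exact coe_mul_top_ne_bot (hp j)
    · exact EReal.coe_ne_bot _
  · rw [if_pos hq, slopeAtTop_hellinger hα,
      EReal.coe_mul_top_of_pos (lt_of_le_of_ne (hp i) (Ne.symm hpi))]

theorem coe_sum {ι : Type*} (s : Finset ι) (f : ι → ℝ) :
    ((∑ i ∈ s, f i : ℝ) : EReal) = ∑ i ∈ s, (f i : EReal) := by
  classical
  induction s using Finset.induction_on with
  | empty => simp
  | insert i s his ih => rw [Finset.sum_insert his, Finset.sum_insert his, EReal.coe_add, ih]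

theorem fDiv_hellinger_of_ac {A : Type u} [Fintype A] (α : ℝ) {p q : A → ℝ}
    (h : ∀ i, q i = 0 → p i = 0) :
    fDiv (hellinger α) p q =
      (((∑ i, q i * (p i / q i) ^ α - ∑ i, q i) / (α - 1) : ℝ) : EReal) := by
  rw [← Finset.sum_sub_distrib, Finset.sum_div, coe_sum]
  refine Finset.sum_congr rfl fun i _ => ?_
  split_ifs with hi
  · simp [hi, h i hi]
  · rw [hellinger]
    congr 1
    ring

/-- The factor `R x` cancels in the likelihood ratio. The hypothesis is absolute continuity of the
joint law: `powerMean` vanishes at `y` only if every `R x * condYX P x y` does. -/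
theorem fDiv_joint_of_ac (P : Dist (X × Y)) {α : ℝ} (hα : 1 < α) (R : Dist X) (Q : Dist Y)
    (h : ∀ y, Q.1 y = 0 → powerMean α P R.1 y = 0) :
    fDiv (hellinger α) (fun z : X × Y => R.1 z.1 * condYX P z.1 z.2)
      (fun z : X × Y => R.1 z.1 * Q.1 z.2) =
      (((∑ y, Q.1 y * (powerMean α P R.1 y / Q.1 y ^ α) - 1) / (α - 1) : ℝ) : EReal) := by
  have hα0 : α ≠ 0 := by linarith
  rw [fDiv_hellinger_of_ac α]
  · have h1 : ∑ z : X × Y, R.1 z.1 * Q.1 z.2 = 1 := by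
      rw [Fintype.sum_prod_type]
      simp only
      simp_rw [← Finset.mul_sum]
      rw [Q.2.2]
      simp [R.2.2]
    have h2 : ∑ z : X × Y, R.1 z.1 * Q.1 z.2 *
        (R.1 z.1 * condYX P z.1 z.2 / (R.1 z.1 * Q.1 z.2)) ^ α =
        ∑ y, Q.1 y * (powerMean α P R.1 y / Q.1 y ^ α) := by
      rw [Fintype.sum_prod_type, Finset.sum_comm]
      refine Finset.sum_congr rfl fun y _ => ?_
      rw [powerMean, Finset.sum_div, Finset.mul_sum]
      refine Finset.sum_congr rfl fun x _ => ?_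
      simp only
      rcases eq_or_ne (R.1 x) 0 with hx | hx
      · simp [hx]
      · rw [mul_div_mul_left _ _ hx, Real.div_rpow (condYX_nonneg P x y) (Q.2.1 y)]
        ring
    rw [h1, h2]
  · rintro ⟨x, y⟩ hxy
    simp only at hxy ⊢
    rcases mul_eq_zero.1 hxy with hx | hy
    · rw [hx, zero_mul]
    · have := (Finset.sum_eq_zero_iff_of_nonneg (fun x _ => mul_nonneg (R.2.1 x)
        (Real.rpow_nonneg (condYX_nonneg P x y) _))).1 (h y hy) x (Finset.mem_univ x)
      rcases mul_eq_zero.1 this with hx | hk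
      · rw [hx, zero_mul]
      · rw [(Real.rpow_eq_zero (condYX_nonneg P x y) hα0).1 hk, mul_zero]

/-- Jensen for `t ↦ t^α` with weights `Q`, at the points `powerMean^(1/α) / Q`, whose `Q`-average is
Gallager's sum. -/
theorem le_fDiv_joint (P : Dist (X × Y)) {α : ℝ} (hα : 1 < α) (R : Dist X) (Q : Dist Y) :
    (((gallagerSum α P R.1 ^ α - 1) / (α - 1) : ℝ) : EReal) ≤
      fDiv (hellinger α) (fun z : X × Y => R.1 z.1 * condYX P z.1 z.2)
        (fun z : X × Y => R.1 z.1 * Q.1 z.2) := by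
  have hα0 : α ≠ 0 := by linarith
  have hα1 : 0 < α - 1 := by linarith
  by_cases h : ∀ y, Q.1 y = 0 → powerMean α P R.1 y = 0
  · rw [fDiv_joint_of_ac P hα R Q h, EReal.coe_le_coe_iff]
    gcongr
    have := Real.rpow_arith_mean_le_arith_mean_rpow Finset.univ Q.1
      (fun y => powerMean α P R.1 y ^ (1 / α) / Q.1 y) (fun y _ => Q.2.1 y) Q.2.2
      (fun y _ => div_nonneg (Real.rpow_nonneg (powerMean_nonneg α P R y) _) (Q.2.1 y)) hα.le
    have h1 : gallagerSum α P R.1 = ∑ y, Q.1 y * (powerMean α P R.1 y ^ (1 / α) / Q.1 y) := by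
      refine Finset.sum_congr rfl fun y _ => ?_
      rcases eq_or_ne (Q.1 y) 0 with hy | hy
      · rw [h y hy, Real.zero_rpow (one_div_ne_zero hα0)]
        simp
      · rw [mul_div_cancel₀ _ hy]
    rw [h1]
    refine this.trans_eq (Finset.sum_congr rfl fun y _ => ?_)
    rw [Real.div_rpow (Real.rpow_nonneg (powerMean_nonneg α P R _) _) (Q.2.1 _),
      ← Real.rpow_mul (powerMean_nonneg α P R _), one_div_mul_cancel hα0, Real.rpow_one]
  · push Not at h
    obtain ⟨y, hy, hne⟩ := h
    obtain ⟨x, -, hx⟩ := Finset.exists_ne_zero_of_sum_ne_zero hne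
    rw [fDiv_hellinger_eq_top hα (fun z => mul_nonneg (R.2.1 _) (condYX_nonneg P _ _))]
    · exact le_top
    · refine ⟨(x, y), by simp [hy], mul_ne_zero (left_ne_zero_of_mul hx) fun hk => ?_⟩
      exact right_ne_zero_of_mul hx (by rw [hk, Real.zero_rpow hα0])

theorem iInf_fDiv_joint (P : Dist (X × Y)) {α : ℝ} (hα : 1 < α) {R : Dist X}
    (hR : Function.support R.1 = Function.support (margX P)) :
    ⨅ Q : Dist Y, fDiv (hellinger α) (fun z : X × Y => R.1 z.1 * condYX P z.1 z.2)
        (fun z : X × Y => R.1 z.1 * Q.1 z.2) =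
      (((gallagerSum α P R.1 ^ α - 1) / (α - 1) : ℝ) : EReal) := by
  have hα0 : α ≠ 0 := by linarith
  have hc : 0 < gallagerSum α P R.1 := zero_lt_one.trans_le (one_le_gallagerSum P hα hR)
  have hg := fun y => powerMean_nonneg α P R y
  refine le_antisymm ?_ (le_iInf fun Q => le_fDiv_joint P hα R Q)
  -- Sibson's minimizer, for which the points in the Jensen bound are all equal.
  have hmem : (fun y => powerMean α P R.1 y ^ (1 / α) / gallagerSum α P R.1) ∈ stdSimplex ℝ Y := by
    refine ⟨fun y => div_nonneg (Real.rpow_nonneg (hg y) _) hc.le, ?_⟩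
    rw [← Finset.sum_div]
    exact div_self hc.ne'
  refine (iInf_le _ ⟨_, hmem⟩).trans ?_
  · rw [fDiv_joint_of_ac P hα R _ ?_]
    · refine le_of_eq ?_
      congr 3
      have key : ∀ y, powerMean α P R.1 y ^ (1 / α) / gallagerSum α P R.1 *
          (powerMean α P R.1 y / (powerMean α P R.1 y ^ (1 / α) / gallagerSum α P R.1) ^ α) =
          powerMean α P R.1 y ^ (1 / α) * (gallagerSum α P R.1 ^ α / gallagerSum α P R.1) := by
        intro y
        rw [Real.div_rpow (Real.rpow_nonneg (hg y) _) hc.le,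
          ← Real.rpow_mul (hg y), one_div_mul_cancel hα0, Real.rpow_one]
        rcases eq_or_ne (powerMean α P R.1 y) 0 with h | h
        · simp [h, Real.zero_rpow (inv_ne_zero hα0)]
        · field_simp
      simp only [key]
      rw [← Finset.sum_mul]
      exact mul_div_cancel₀ _ hc.ne'
    · intro y hy
      rcases div_eq_zero_iff.1 hy with h | h
      · exact (Real.rpow_eq_zero (hg y) (one_div_ne_zero hα0)).1 h
      · exact absurd h hc.ne'

theorem maxFLeakage_hellinger (P : Dist (X × Y)) {α : ℝ} (hα : 1 < α) :
    maxFLeakage (hellinger α) P =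
      ⨆ (R : Dist X) (_ : Function.support R.1 = Function.support (margX P)),
        (((gallagerSum α P R.1 ^ α - 1) / (α - 1) : ℝ) : EReal) :=
  iSup_congr fun _ => iSup_congr fun hR => iInf_fDiv_joint P hα hR

end Hellinger

/-! ### Comparison of the two suprema -/

section Leakage

variable {X : Type u} {Y : Type v} [Fintype X] [Fintype Y]

theorem exists_logGain_le (P : Dist (X × Y)) {U : Type w} [Fintype U] (W : Channel X U)
    {α : ℝ} (hα : 1 < α) :
    ∃ R : Dist X, Function.support R.1 = Function.support (margX P) ∧
      logGain P W α ≤ α / (α - 1) * Real.log (gallagerSum α P R.1) := by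
  have hα0 : 0 < α := by linarith
  have hα1 : 0 < α - 1 := by linarith
  have hZ := sum_margU_rpow_pos P W α
  set Z := ∑ i, margU P W i ^ α with hZdef
  -- the posterior `P_{X|U}`
  let B : U → X → ℝ := fun i x => (W x).1 i * margX P x / margU P W i
  have hB0 : ∀ i x, 0 ≤ B i x := fun i x =>
    div_nonneg (mul_nonneg ((W x).2.1 i) (margX_nonneg P x)) (margU_nonneg P W i)
  have hB1 : ∀ i, margU P W i ≠ 0 → ∑ x, B i x = 1 := fun i hi => by
    simp only [B]
    rw [← Finset.sum_div, ← margU_eq, div_self hi]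
  have hR0 : ∀ x, 0 ≤ ∑ i, margU P W i ^ α / Z * B i x := fun x =>
    Finset.sum_nonneg fun i _ =>
      mul_nonneg (div_nonneg (Real.rpow_nonneg (margU_nonneg P W i) α) hZ.le) (hB0 i x)
  -- Letters `i` of probability zero have an ill-defined posterior but get weight `0^α = 0`.
  let R : Dist X := ⟨fun x => ∑ i, margU P W i ^ α / Z * B i x, hR0, by
    rw [Finset.sum_comm]
    have : ∀ i, ∑ x, margU P W i ^ α / Z * B i x = margU P W i ^ α / Z := fun i => by
      rw [← Finset.mul_sum]
      rcases eq_or_ne (margU P W i) 0 with hi | hi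
      · simp [hi, Real.zero_rpow hα0.ne']
      · rw [hB1 i hi, mul_one]
    simp only [this]
    rw [← Finset.sum_div, ← hZdef, div_self hZ.ne']⟩
  have hsupp : Function.support R.1 = Function.support (margX P) := by
    ext x
    simp only [Function.mem_support, R]
    constructor
    · intro h hx
      exact h (Finset.sum_eq_zero fun i _ => by simp [B, hx])
    · intro hx
      have hxpos : 0 < margX P x := lt_of_le_of_ne (margX_nonneg P x) (Ne.symm hx)
      obtain ⟨i, -, hi⟩ : ∃ i ∈ Finset.univ, 0 < (W x).1 i := by
        apply Finset.exists_lt_of_sum_lt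
        simp [(W x).2.2]
      have hu : 0 < margU P W i := by
        rw [margU_eq]
        exact Finset.sum_pos' (fun x _ => mul_nonneg ((W x).2.1 i) (margX_nonneg P x))
          ⟨x, Finset.mem_univ x, mul_pos hi hxpos⟩
      refine (Finset.sum_pos' (fun i _ => mul_nonneg
        (div_nonneg (Real.rpow_nonneg (margU_nonneg P W i) α) hZ.le) (hB0 i x))
        ⟨i, Finset.mem_univ i, ?_⟩).ne'
      exact mul_pos (div_pos (Real.rpow_pos_of_pos hu α) hZ) (div_pos (mul_pos hi hxpos) hu)
  refine ⟨R, hsupp, ?_⟩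
  rw [logGain_eq P W hα, ← hZdef]
  have hZp := Real.rpow_pos_of_pos hZ (1 / α)
  refine mul_le_mul_of_nonneg_left (Real.log_le_log
    (div_pos (sum_jointUY_rpow_pos P W α) hZp) ?_) (by positivity)
  rw [Finset.sum_div]
  refine Finset.sum_le_sum fun y _ => ?_
  rw [← Real.div_rpow (Finset.sum_nonneg fun i _ =>
    Real.rpow_nonneg (jointUY_nonneg P W i y) α) hZ.le]
  refine Real.rpow_le_rpow (div_nonneg (Finset.sum_nonneg fun i _ =>
    Real.rpow_nonneg (jointUY_nonneg P W i y) α) hZ.le) ?_ (by positivity)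
  -- By the Markov property `P_{Y|U}(y|i)` is the posterior average of `P_{Y|X}(y|x)`, so convexity
  -- of `t^α` applies.
  have hjensen : ∀ i, jointUY P W i y ^ α ≤
      margU P W i ^ α * ∑ x, B i x * condYX P x y ^ α := by
    intro i
    rcases eq_or_ne (margU P W i) 0 with hi | hi
    · have : jointUY P W i y = 0 :=
        (Finset.sum_eq_zero_iff_of_nonneg fun y _ => jointUY_nonneg P W i y).1 hi y
          (Finset.mem_univ y)
      rw [this, hi, Real.zero_rpow hα0.ne', zero_mul]
    · have hj : jointUY P W i y = margU P W i * ∑ x, B i x * condYX P x y := by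
        rw [jointUY, Finset.mul_sum]
        refine Finset.sum_congr rfl fun x _ => ?_
        rw [← margX_mul_condYX]
        simp only [B]
        field_simp
      rw [hj, Real.mul_rpow (margU_nonneg P W i) (Finset.sum_nonneg fun x _ =>
        mul_nonneg (hB0 i x) (condYX_nonneg P x y))]
      exact mul_le_mul_of_nonneg_left (Real.rpow_arith_mean_le_arith_mean_rpow _ _ _
        (fun x _ => hB0 i x) (hB1 i hi) (fun x _ => condYX_nonneg P x y) hα.le)
        (Real.rpow_nonneg (margU_nonneg P W i) α)
  rw [div_le_iff₀ hZ]
  refine (Finset.sum_le_sum fun i _ => hjensen i).trans (le_of_eq ?_)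
  simp only [powerMean, R, Finset.mul_sum, Finset.sum_mul]
  rw [Finset.sum_comm]
  refine Finset.sum_congr rfl fun x _ => Finset.sum_congr rfl fun i _ => ?_
  field_simp

/-- The channel splitting each letter `x` into `m x` equiprobable ones. -/
theorem exists_logGain_splitting (P : Dist (X × Y)) {α : ℝ} (hα : 1 < α) (m : X → ℕ)
    (hm : ∀ x, 0 < m x) :
    ∃ (n : ℕ) (W : Channel X (Fin n)), logGain P W α = α / (α - 1) * Real.log
      ((∑ y, (∑ x, (m x : ℝ) ^ (1 - α) * P.1 (x, y) ^ α) ^ (1 / α)) /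
        (∑ x, (m x : ℝ) ^ (1 - α) * margX P x ^ α) ^ (1 / α)) := by
  classical
  have hα0 : α ≠ 0 := by linarith
  have hm' : ∀ x, 0 < (m x : ℝ) := fun x => Nat.cast_pos.2 (hm x)
  let e : (Σ x, Fin (m x)) ≃ Fin (Fintype.card (Σ x, Fin (m x))) := Fintype.equivFin _
  let W : Channel X (Fin (Fintype.card (Σ x, Fin (m x)))) := fun x =>
    ⟨fun i => if (e.symm i).1 = x then (m x : ℝ)⁻¹ else 0, fun i => by
      beta_reduce
      split_ifs
      · exact (inv_pos.2 (hm' x)).le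
      · exact le_rfl, by
      rw [← e.sum_comp, Fintype.sum_sigma]
      simp [(hm' x).ne']⟩
  have hW : ∀ (q : X → ℝ) (s : Σ x, Fin (m x)),
      ∑ x, (W x).1 (e s) * q x = (m s.1 : ℝ)⁻¹ * q s.1 := by
    intro q s
    simp [W]
  -- Each `x` yields `m x` letters of mass `q x / m x`, contributing `m x * (q x / m x)^α` in total.
  have hpow : ∀ q : X → ℝ, (∀ x, 0 ≤ q x) →
      ∑ i, (∑ x, (W x).1 i * q x) ^ α = ∑ x, (m x : ℝ) ^ (1 - α) * q x ^ α := by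
    intro q hq
    rw [← e.sum_comp, Fintype.sum_sigma]
    refine Finset.sum_congr rfl fun x _ => ?_
    simp only [hW]
    rw [Finset.sum_const, Finset.card_univ, Fintype.card_fin, nsmul_eq_mul,
      Real.mul_rpow (inv_nonneg.2 (hm' x).le) (hq x), Real.inv_rpow (hm' x).le,
      Real.rpow_sub (hm' x), Real.rpow_one]
    ring
  refine ⟨_, W, ?_⟩
  rw [logGain_eq P W hα]
  simp only [margU_eq, jointUY]
  rw [hpow _ (margX_nonneg P)]
  simp only [hpow _ (fun x => P.2.1 (x, _))]

theorem le_maxAlphaLeakage (P : Dist (X × Y)) {α : ℝ} (hα : 1 < α) {R : Dist X}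
    (hR : Function.support R.1 = Function.support (margX P)) :
    ((α / (α - 1) * Real.log (gallagerSum α P R.1) : ℝ) : EReal) ≤ maxAlphaLeakage P α := by
  have hα0 : 0 < α := by linarith
  have hα1 : 0 < α - 1 := by linarith
  have hiff : ∀ x, R.1 x = 0 ↔ margX P x = 0 := fun x => by
    have := Set.ext_iff.1 hR x
    simp only [Function.mem_support] at this
    exact not_iff_not.1 this
  -- `t` is the limiting proportion of the number of letters into which each `x` is split
  obtain ⟨t, ht0, ht⟩ : ∃ t : X → ℝ, (∀ x, 0 < t x) ∧
      ∀ x, t x ^ (1 - α) * margX P x ^ α = R.1 x := by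
    -- Solve `t^(1-α) P_X^α = R` for `t`. Off the support both sides vanish, so any positive value
    -- serves.
    refine ⟨fun x => if R.1 x = 0 then 1 else (margX P x ^ α / R.1 x) ^ (1 / (α - 1)),
      fun x => ?_, fun x => ?_⟩
    · beta_reduce
      split_ifs with h
      · exact one_pos
      · have h1 : 0 < R.1 x := lt_of_le_of_ne (R.2.1 x) (Ne.symm h)
        have h2 : 0 < margX P x :=
          lt_of_le_of_ne (margX_nonneg P x) (Ne.symm fun h' => h ((hiff x).2 h'))
        positivity
    · simp only
      split_ifs with h
      · rw [h, (hiff x).1 h, Real.zero_rpow hα0.ne', mul_zero]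
      · have h1 : 0 < R.1 x := lt_of_le_of_ne (R.2.1 x) (Ne.symm h)
        have h2 : 0 < margX P x :=
          lt_of_le_of_ne (margX_nonneg P x) (Ne.symm fun h' => h ((hiff x).2 h'))
        have h3 : 0 < margX P x ^ α := by positivity
        have h4 : 1 / (α - 1) * (1 - α) = -1 := by field_simp; ring
        rw [← Real.rpow_mul (by positivity), h4, Real.rpow_neg_one]
        field_simp
  -- Rounding up keeps every count positive, as splitting requires.
  let m : ℕ → X → ℕ := fun N x => ⌈t x * (N : ℝ)⌉₊
  have hm : ∀ N : ℕ, 0 < N → ∀ x, 0 < m N x := fun N hN x =>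
    Nat.ceil_pos.2 (mul_pos (ht0 x) (Nat.cast_pos.2 hN))
  have hlim : ∀ x, Tendsto (fun N : ℕ => (m N x : ℝ) / N) atTop (𝓝 (t x)) := fun x =>
    (tendsto_nat_ceil_mul_div_atTop (ht0 x).le).comp tendsto_natCast_atTop_atTop
  have hS : ∀ q : X → ℝ, Tendsto (fun N : ℕ => ∑ x, ((m N x : ℝ) / N) ^ (1 - α) * q x ^ α) atTop
      (𝓝 (∑ x, t x ^ (1 - α) * q x ^ α)) := fun q =>
    tendsto_finsetSum _ fun x _ => ((hlim x).rpow_const (Or.inl (ht0 x).ne')).mul_const _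
  have hden : ∑ x, t x ^ (1 - α) * margX P x ^ α = 1 := by
    refine Eq.trans (Finset.sum_congr rfl fun x _ => ht x) R.2.2
  have hnum : ∀ y, ∑ x, t x ^ (1 - α) * P.1 (x, y) ^ α = powerMean α P R.1 y := fun y => by
    refine Finset.sum_congr rfl fun x _ => ?_
    rw [← margX_mul_condYX, Real.mul_rpow (margX_nonneg P x) (condYX_nonneg P x y), ← mul_assoc,
      ht x]
  have hc : 0 < gallagerSum α P R.1 := zero_lt_one.trans_le (one_le_gallagerSum P hα hR)
  have hinv : 0 ≤ 1 / α := by positivity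
  have hT : Tendsto (fun N : ℕ => α / (α - 1) * Real.log
      ((∑ y, (∑ x, ((m N x : ℝ) / N) ^ (1 - α) * P.1 (x, y) ^ α) ^ (1 / α)) /
        (∑ x, ((m N x : ℝ) / N) ^ (1 - α) * margX P x ^ α) ^ (1 / α))) atTop
      (𝓝 (α / (α - 1) * Real.log (gallagerSum α P R.1))) := by
    have h1 := tendsto_finsetSum (Finset.univ : Finset Y) fun y _ =>
      (hS fun x => P.1 (x, y)).rpow_const (p := 1 / α) (Or.inr hinv)
    simp only [hnum] at h1
    have h2 := (hS (margX P)).rpow_const (p := 1 / α) (Or.inr hinv)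
    rw [hden, Real.one_rpow] at h2
    have h3 := h1.div h2 one_ne_zero
    rw [div_one] at h3
    exact (h3.log hc.ne').const_mul _
  have hT' := (continuous_coe_real_ereal.tendsto _).comp hT
  refine le_of_tendsto hT' ?_
  filter_upwards [eventually_gt_atTop 0] with N hN
  have hN' : 0 < (N : ℝ) := Nat.cast_pos.2 hN
  obtain ⟨n, W, hW⟩ := exists_logGain_splitting P hα (m N) (hm N hN)
  -- Replacing `m` by the proportions `m / N` multiplies the numerator and denominator of the gain
  -- ratio by the same power of `N`.
  have hscale : ∀ q : X → ℝ, ∑ x, (m N x : ℝ) ^ (1 - α) * q x ^ α =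
      (N : ℝ) ^ (1 - α) * ∑ x, ((m N x : ℝ) / N) ^ (1 - α) * q x ^ α := fun q => by
    rw [Finset.mul_sum]
    refine Finset.sum_congr rfl fun x _ => ?_
    rw [← mul_assoc, ← Real.mul_rpow hN'.le (by positivity), mul_div_cancel₀ _ hN'.ne']
  have hsum : ∀ q : X → ℝ, (∀ x, 0 ≤ q x) →
      0 ≤ ∑ x, ((m N x : ℝ) / N) ^ (1 - α) * q x ^ α := fun q hq =>
    Finset.sum_nonneg fun x _ => mul_nonneg (by positivity) (Real.rpow_nonneg (hq x) α)
  have hNp : 0 < (N : ℝ) ^ (1 - α) := Real.rpow_pos_of_pos hN' _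
  have hWN : logGain P W α = α / (α - 1) * Real.log
      ((∑ y, (∑ x, ((m N x : ℝ) / N) ^ (1 - α) * P.1 (x, y) ^ α) ^ (1 / α)) /
        (∑ x, ((m N x : ℝ) / N) ^ (1 - α) * margX P x ^ α) ^ (1 / α)) := by
    rw [hW, hscale (margX P), Real.mul_rpow hNp.le (hsum _ (margX_nonneg P))]
    have : ∀ y, (∑ x, (m N x : ℝ) ^ (1 - α) * P.1 (x, y) ^ α) ^ (1 / α) =
        ((N : ℝ) ^ (1 - α)) ^ (1 / α) *
          (∑ x, ((m N x : ℝ) / N) ^ (1 - α) * P.1 (x, y) ^ α) ^ (1 / α) := fun y => by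
      rw [hscale fun x => P.1 (x, y), Real.mul_rpow hNp.le (hsum _ fun x => P.2.1 _)]
    simp only [this]
    rw [← Finset.mul_sum, mul_div_mul_left _ _ (Real.rpow_pos_of_pos hNp _).ne']
  rw [maxAlphaLeakage_eq P hα, Function.comp_apply, ← hWN]
  exact le_iSup₂ (f := fun (n : ℕ) (W : Channel X (Fin n)) => ((logGain P W α : ℝ) : EReal)) n W

theorem logGain_bound_eq {c α : ℝ} (hc : 0 < c) :
    α / (α - 1) * Real.log c = 1 / (α - 1) * Real.log (c ^ α) := by
  rw [Real.log_rpow hc]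
  ring

theorem margX_mem (P : Dist (X × Y)) : margX P ∈ stdSimplex ℝ X :=
  ⟨margX_nonneg P, sum_margX P⟩

theorem maxFLeakage_hellinger_nonneg (P : Dist (X × Y)) {α : ℝ} (hα : 1 < α) :
    0 ≤ maxFLeakage (hellinger α) P := by
  have hα1 : 0 < α - 1 := by linarith
  rw [maxFLeakage_hellinger P hα]
  refine le_trans ?_ (le_iSup₂ (f := fun (R : Dist X)
    (_ : Function.support R.1 = Function.support (margX P)) =>
      (((gallagerSum α P R.1 ^ α - 1) / (α - 1) : ℝ) : EReal)) ⟨margX P, margX_mem P⟩ rfl)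
  rw [EReal.coe_nonneg]
  refine div_nonneg (sub_nonneg.2 (Real.one_le_rpow ?_ (by linarith))) hα1.le
  exact one_le_gallagerSum P hα (R := ⟨margX P, margX_mem P⟩) rfl

theorem maxFLeakage_hellinger_lt_top (P : Dist (X × Y)) {α : ℝ} (hα : 1 < α) :
    maxFLeakage (hellinger α) P < ⊤ := by
  have hα1 : 0 < α - 1 := by linarith
  rw [maxFLeakage_hellinger P hα]
  refine lt_of_le_of_lt (iSup₂_le fun R hR => ?_)
    (EReal.coe_lt_top (((Fintype.card Y : ℝ) ^ α - 1) / (α - 1)))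
  rw [EReal.coe_le_coe_iff]
  have := one_le_gallagerSum P hα hR
  gcongr
  exact gallagerSum_le_card P hα R

theorem maxAlphaLeakage_eq_log (P : Dist (X × Y)) {α : ℝ} (hα : 1 < α) :
    maxAlphaLeakage P α = ((1 / (α - 1) * Real.log
      (1 + (α - 1) * (maxFLeakage (hellinger α) P).toReal) : ℝ) : EReal) := by
  have hα0 : 0 < α := by linarith
  have hα1 : 0 < α - 1 := by linarith
  have hM0 := maxFLeakage_hellinger_nonneg P hα
  have hMtop := maxFLeakage_hellinger_lt_top P hα
  have hMcoe : ((maxFLeakage (hellinger α) P).toReal : EReal) = maxFLeakage (hellinger α) P :=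
    EReal.coe_toReal hMtop.ne (fun h => by rw [h] at hM0; simp at hM0)
  have hM0' : 0 ≤ (maxFLeakage (hellinger α) P).toReal := EReal.toReal_nonneg hM0
  rw [maxFLeakage_hellinger P hα] at hMcoe
  rw [maxFLeakage_hellinger P hα] at hM0' ⊢
  set M := (⨆ (R : Dist X) (_ : Function.support R.1 = Function.support (margX P)),
    (((gallagerSum α P R.1 ^ α - 1) / (α - 1) : ℝ) : EReal)).toReal
  apply le_antisymm
  · rw [maxAlphaLeakage_eq P hα]
    refine iSup₂_le fun n W => ?_
    obtain ⟨R, hR, hle⟩ := exists_logGain_le P W hα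
    have hc : 0 < gallagerSum α P R.1 := zero_lt_one.trans_le (one_le_gallagerSum P hα hR)
    rw [EReal.coe_le_coe_iff]
    refine hle.trans ?_
    rw [logGain_bound_eq hc]
    have h1 : (gallagerSum α P R.1 ^ α - 1) / (α - 1) ≤ M := by
      rw [← EReal.coe_le_coe_iff, hMcoe]
      exact le_iSup₂ (f := fun (R : Dist X)
        (_ : Function.support R.1 = Function.support (margX P)) =>
          (((gallagerSum α P R.1 ^ α - 1) / (α - 1) : ℝ) : EReal)) R hR
    rw [div_le_iff₀ hα1] at h1
    have := Real.rpow_pos_of_pos hc α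
    gcongr
    linarith
  · have hle := fun (R : Dist X) hR => le_maxAlphaLeakage P hα (R := R) hR
    -- Testing a real upper bound `z` and inverting the logarithm for each `R` avoids commuting the
    -- logarithm with the supremum.
    generalize maxAlphaLeakage P α = L at hle ⊢
    induction L with
    | bot => exact absurd (le_bot_iff.1 (hle ⟨margX P, margX_mem P⟩ rfl)) (EReal.coe_ne_bot _)
    | top => exact le_top
    | coe z =>
      have h2 : M ≤ (Real.exp ((α - 1) * z) - 1) / (α - 1) := by
        rw [← EReal.coe_le_coe_iff, hMcoe]
        refine iSup₂_le fun R hR => ?_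
        have hc : 0 < gallagerSum α P R.1 := zero_lt_one.trans_le (one_le_gallagerSum P hα hR)
        have h3 := hle R hR
        rw [EReal.coe_le_coe_iff] at h3 ⊢
        rw [logGain_bound_eq hc, one_div, inv_mul_le_iff₀ hα1,
          Real.log_le_iff_le_exp (Real.rpow_pos_of_pos hc α)] at h3
        gcongr
      rw [le_div_iff₀ hα1] at h2
      rw [EReal.coe_le_coe_iff, one_div, inv_mul_le_iff₀ hα1,
        Real.log_le_iff_le_exp (by positivity)]
      linarith

end Leakage

end AlphaLeakage

end

theorem lemma1 {X Y : Type*} [Fintype X] [Fintype Y]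
    (P : AlphaLeakage.Dist (X × Y)) (α : ℝ) (hα : 1 < α) :
    -- the limits in the definition of maximal `α`-leakage exist
    (∀ (n : ℕ) (W : AlphaLeakage.Channel X (Fin n)),
      ∃ l : ℝ, Tendsto (AlphaLeakage.logGain P W) (𝓝[≠] α) (𝓝 l)) ∧
    -- the `f_α`-leakage is a nonnegative real number
    0 ≤ AlphaLeakage.maxFLeakage (AlphaLeakage.hellinger α) P ∧
    AlphaLeakage.maxFLeakage (AlphaLeakage.hellinger α) P < ⊤ ∧
    -- the identity
    AlphaLeakage.maxAlphaLeakage P α =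
      ((1 / (α - 1) * Real.log
        (1 + (α - 1) * (AlphaLeakage.maxFLeakage (AlphaLeakage.hellinger α) P).toReal) : ℝ) :
          EReal) :=
  ⟨fun _ W => ⟨_, AlphaLeakage.tendsto_logGain P W hα⟩,
    AlphaLeakage.maxFLeakage_hellinger_nonneg P hα,
    AlphaLeakage.maxFLeakage_hellinger_lt_top P hα,
    AlphaLeakage.maxAlphaLeakage_eq_log P hα⟩
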